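/- Let $F$ be an algebraically closed field of characteristic $0$. For $\alpha\in F$ and an integer $s\ge 1$ let $J(\alpha,s)$ denote the $s\times s$ Jordan block with $\alpha$ on the diagonal, $1$ on the superdiagonal and $0$ elsewhere. Let $\alpha_1,\dots,\alpha_t\in F$ be nonzero and let $0<r_1\le r_2\le\cdots\le r_t$ be integers. Put $\alpha=\prod_{i=1}^t\alpha_i$ and $n=\sum_{j=1}^t r_j-t$, define integers $c_0,\dots,c_n$ by $$\prod_{j=1}^t\bigl(1+x+\cdots+x^{r_j-1}\bigr)=\sum_{k=0}^n c_kx^k,$$ and set $c_{-1}=0$. Then $c_k-c_{k-1}\ge 0$ for $0\le k\le\lfloor n/2\rfloor$, and the Jordan canonical form (unique up to the order of the blocks) of the tensor (Kronecker) product $J(\alpha_1,r_1)\otimes J(\alpha_2,r_2)\otimes\cdots\otimes J(\alpha_t,r_t)$ is $$\bigoplus_{k=0}^{\lfloor n/2\rfloor}J(\alpha,\,n+1-2k)^{\oplus(c_k-c_{k-1})}.$$ -/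

import Mathlib

/-- The Jordan block `J(a, s)`: `a` on the diagonal, `1` on the superdiagonal, `0` elsewhere. -/
def jordanBlock {K : Type*} [Field K] (a : K) (s : ℕ) : Matrix (Fin s) (Fin s) K :=
  Matrix.of fun i j => if i = j then a else if (i : ℕ) + 1 = (j : ℕ) then 1 else 0

/-- The tensor (Kronecker) product of a finite family of square matrices: its rows and columns are
indexed by tuples, and the entry at `(x, y)` is the product of the entries at `(x j, y j)`. -/
def tensorMatrix {K : Type*} [Field K] {t : ℕ} {r : Fin t → ℕ}
    (A : (j : Fin t) → Matrix (Fin (r j)) (Fin (r j)) K) :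
    Matrix ((j : Fin t) → Fin (r j)) ((j : Fin t) → Fin (r j)) K :=
  Matrix.of fun x y => ∏ j, A j (x j) (y j)

/-- `IsJordanForm A S`: the Jordan canonical form of the square matrix `A` is the direct sum of the
Jordan blocks `J(a, s)`, `(a, s)` running through the multiset `S`. That is, all `s` are positive
and, for an enumeration `b` of `S`, the matrix `A` is similar to the block diagonal matrix with
blocks `J(a, s)`; the bijection `e` only renames the rows and columns. -/
def IsJordanForm {K : Type*} [Field K] {ι : Type*} [Fintype ι] [DecidableEq ι]
    (A : Matrix ι ι K) (S : Multiset (K × ℕ)) : Prop :=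
  ∃ (m : ℕ) (b : Fin m → K × ℕ),
    Finset.univ.val.map b = S ∧ (∀ i, 0 < (b i).2) ∧
    ∃ (e : ι ≃ (i : Fin m) × Fin (b i).2) (P : (Matrix ι ι K)ˣ),
      (P : Matrix ι ι K) * A * ((P⁻¹ : (Matrix ι ι K)ˣ) : Matrix ι ι K) =
        (Matrix.blockDiagonal' fun i => jordanBlock (b i).1 (b i).2).submatrix e e

/-- The coefficient `c_k` of `x ^ k` in `∏ j, (1 + x + ⋯ + x ^ (r j - 1))`, for any integer `k`;
it is `0` for negative `k`. -/
noncomputable def blockCoeff {t : ℕ} (r : Fin t → ℕ) (k : ℤ) : ℤ :=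
  if 0 ≤ k then
    (∏ j, ∑ i ∈ Finset.range (r j), (Polynomial.X : Polynomial ℤ) ^ i).coeff k.toNat
  else 0

/-! Let M be the tensor product minus α. Grade the coordinates by the sum of the indices
(`tupleDegree`). Every term of M lowers this degree by at least one, so M is nilpotent, and the part
lowering it by exactly one is E = `loweringSum`, a sum of nilpotent blocks on single factors with
nonzero weights. The operator F = `raisingSum` satisfies [E, F] = n - 2d on degree d. In
characteristic 0 the usual sl₂ computation then makes E^i injective on degree k when n + i ≤ 2k.
Since degrees d and n - d have equal dimension, E^i also maps degree d + i onto degree d when 2d + i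
≤ n.

Both facts pass from E to M by triangularity (`nullity_filtered_pow`): the span W of the degrees
with 2d + i ≤ n lies in the range of M^i, and its preimage is the span of the degrees with 2d ≤ n +
i. Hence the nullity of M^i is a difference of two counts of tuples.

The number of Jordan blocks of a given size is minus a second difference of nullities
(`IsJordanForm.two_mul_nullity`); with the symmetry of degrees it becomes c_k - c_{k-1}, which is
nonnegative because it is a multiplicity. Some Jordan form exists by the structure of torsion
K[X]-modules (`exists_isJordanForm`), so uniqueness shows that the stated multiset is one. -/

open Module

/-! ### Nullity of matrices and coordinate subspaces -/

section Nullity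

variable {K : Type*} [Field K] {ι κ : Type*} [Fintype ι] [Fintype κ]

/-- The subspace of vectors that vanish at all coordinates not satisfying `p`. -/
def coordSubspace (K : Type*) [Field K] {ι : Type*} (p : ι → Prop) : Submodule K (ι → K) where
  carrier := {f | ∀ x, ¬ p x → f x = 0}
  add_mem' := fun {f g} hf hg x hx => by simp [hf x hx, hg x hx]
  zero_mem' := fun x _ => rfl
  smul_mem' := fun c f hf x hx => by simp [hf x hx]

theorem mem_coordSubspace {ι : Type*} {p : ι → Prop} {f : ι → K} :
    f ∈ coordSubspace K p ↔ ∀ x, ¬ p x → f x = 0 := Iff.rfl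

/-- Vectors supported on `p` are the functions on the subtype `p`. -/
def coordSubspaceEquiv (K : Type*) [Field K] {ι : Type*} (p : ι → Prop) [DecidablePred p] :
    coordSubspace K p ≃ₗ[K] ({x // p x} → K) where
  toFun f x := f.1 x
  map_add' _ _ := rfl
  map_smul' _ _ := rfl
  invFun g := ⟨fun x => if h : p x then g ⟨x, h⟩ else 0, fun x hx => by simp [hx]⟩
  left_inv f := by
    ext x
    by_cases h : p x
    · simp [h]
    · simp [h, f.2 x h]
  right_inv g := by
    ext x
    simp [x.2]

theorem finrank_coordSubspace (p : ι → Prop) [DecidablePred p] :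
    finrank K (coordSubspace K p) = (Finset.univ.filter p).card := by
  rw [(coordSubspaceEquiv K p).finrank_eq, finrank_fintype_fun_eq_card, Fintype.card_subtype]

/-- The dimension of the kernel of a square matrix. -/
noncomputable def nullity (A : Matrix ι ι K) : ℕ := finrank K (LinearMap.ker A.mulVecLin)

theorem rank_add_nullity (A : Matrix ι ι K) : A.rank + nullity A = Fintype.card ι := by
  have := LinearMap.finrank_range_add_finrank_ker A.mulVecLin
  rwa [finrank_fintype_fun_eq_card] at this

theorem nullity_units_conj [DecidableEq ι] (P : (Matrix ι ι K)ˣ) (A : Matrix ι ι K) :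
    nullity ((P : Matrix ι ι K) * A * ((P⁻¹ : (Matrix ι ι K)ˣ) : Matrix ι ι K)) = nullity A := by
  have h1 := rank_add_nullity ((P : Matrix ι ι K) * A * ((P⁻¹ : (Matrix ι ι K)ˣ) : Matrix ι ι K))
  have h2 := rank_add_nullity A
  rw [Matrix.rank_mul_eq_left_of_isUnit_det _ _
      ((Matrix.isUnit_iff_isUnit_det _).1 (P⁻¹).isUnit),
    Matrix.rank_mul_eq_right_of_isUnit_det _ _
      ((Matrix.isUnit_iff_isUnit_det _).1 P.isUnit)] at h1
  omega

theorem nullity_submatrix_equiv (A : Matrix κ κ K) (e : ι ≃ κ) :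
    nullity (A.submatrix e e) = nullity A := by
  have h1 := rank_add_nullity (A.submatrix e e)
  have h2 := rank_add_nullity A
  rw [Matrix.rank_submatrix, Fintype.card_congr e] at h1
  omega

theorem nullity_eq_zero_of_isUnit [DecidableEq ι] {A : Matrix ι ι K} (hA : IsUnit A) :
    nullity A = 0 := by
  have h1 := rank_add_nullity A
  rw [Matrix.rank_of_isUnit A hA] at h1
  omega

theorem blockDiagonal'_mulVec [DecidableEq κ] {m : κ → Type*} [∀ i, Fintype (m i)]
    (A : ∀ i, Matrix (m i) (m i) K) (f : (Σ i, m i) → K) (i : κ) (x : m i) :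
    (Matrix.blockDiagonal' A).mulVec f ⟨i, x⟩ = (A i).mulVec (fun y => f ⟨i, y⟩) x := by
  simp only [Matrix.mulVec, dotProduct, Fintype.sum_sigma]
  rw [Finset.sum_eq_single i]
  · simp [Matrix.blockDiagonal'_apply_eq]
  · intro j _ hj
    exact Finset.sum_eq_zero fun y _ => by
      rw [Matrix.blockDiagonal'_apply_ne _ _ _ hj.symm, zero_mul]
  · simp

theorem nullity_blockDiagonal' [DecidableEq κ] {m : κ → Type*} [∀ i, Fintype (m i)]
    (A : ∀ i, Matrix (m i) (m i) K) :
    nullity (Matrix.blockDiagonal' A) = ∑ i, nullity (A i) := by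
  let e : LinearMap.ker (Matrix.blockDiagonal' A).mulVecLin ≃ₗ[K]
      ∀ i, LinearMap.ker (A i).mulVecLin :=
    { toFun := fun f i => ⟨fun y => f.1 ⟨i, y⟩, by
        ext x
        have := congrFun (LinearMap.mem_ker.1 f.2) ⟨i, x⟩
        rwa [Matrix.mulVecLin_apply, blockDiagonal'_mulVec] at this⟩
      map_add' := fun _ _ => rfl
      map_smul' := fun _ _ => rfl
      invFun := fun g => ⟨fun x => (g x.1).1 x.2, by
        ext ⟨i, x⟩
        have := congrFun (LinearMap.mem_ker.1 (g i).2) x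
        rwa [Matrix.mulVecLin_apply, blockDiagonal'_mulVec]⟩
      left_inv := fun _ => rfl
      right_inv := fun _ => rfl }
  unfold nullity
  rw [e.finrank_eq, finrank_pi_fintype]

end Nullity

/-! ### Nullities of powers determine the Jordan blocks -/

section JordanNullity

variable {K : Type*} [Field K]

theorem jordanBlock_sub_scalar (a b : K) (s : ℕ) :
    jordanBlock a s - b • (1 : Matrix (Fin s) (Fin s) K) = jordanBlock (a - b) s := by
  ext i j
  by_cases h : i = j <;> simp [jordanBlock, h]

theorem jordanBlock_zero_pow_apply (s i : ℕ) (x y : Fin s) :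
    (jordanBlock (0 : K) s ^ i) x y = if (x : ℕ) + i = y then 1 else 0 := by
  induction i generalizing x with
  | zero => simp [Matrix.one_apply, Fin.ext_iff]
  | succ i ih =>
    rw [pow_succ', Matrix.mul_apply]
    simp only [ih]
    by_cases hx : (x : ℕ) + 1 < s
    · rw [Finset.sum_eq_single ⟨x + 1, hx⟩]
      · simp [jordanBlock, Fin.ext_iff, add_assoc, add_comm 1 i]
      · intro z _ hz
        have : ¬ ((x : ℕ) + 1 = z) := fun h => hz (Fin.ext h.symm)
        simp [jordanBlock, this]
      · simp
    · rw [Finset.sum_eq_zero, if_neg (by omega)]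
      intro z _
      have : ¬ ((x : ℕ) + 1 = z) := by omega
      simp [jordanBlock, this]

theorem nullity_jordanBlock_zero_pow (s i : ℕ) :
    nullity (jordanBlock (0 : K) s ^ i) = min s i := by
  -- The i-th power shifts coordinates by i, so it kills exactly the vectors supported on the first
  -- i of them.
  have h : LinearMap.ker (jordanBlock (0 : K) s ^ i).mulVecLin =
      coordSubspace K fun x : Fin s => (x : ℕ) < i := by
    ext f
    rw [LinearMap.mem_ker, mem_coordSubspace, funext_iff]
    have key : ∀ x : Fin s, (jordanBlock (0 : K) s ^ i).mulVecLin f x =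
        if h : (x : ℕ) + i < s then f ⟨x + i, h⟩ else 0 := by
      intro x
      simp only [Matrix.mulVecLin_apply, Matrix.mulVec, dotProduct, jordanBlock_zero_pow_apply]
      split_ifs with h
      · rw [Finset.sum_eq_single ⟨x + i, h⟩]
        · simp
        · intro z _ hz
          rw [if_neg (fun h => hz (Fin.ext h.symm)), zero_mul]
        · simp
      · exact Finset.sum_eq_zero fun z _ => by rw [if_neg (by omega), zero_mul]
    constructor
    · intro hf x hx
      have hxs := x.2
      have h2 := hf ⟨x - i, by omega⟩
      rw [key, dif_pos (by simp; omega)] at h2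
      rw [show x = ⟨(x : ℕ) - i + i, by omega⟩ from Fin.ext (by simp; omega)]
      simpa using h2
    · intro hf x
      rw [key]
      split_ifs with h
      · exact hf _ (by simp)
      · rfl
  unfold nullity
  rw [h, finrank_coordSubspace, Fin.card_filter_val_lt]

theorem isUnit_jordanBlock {a : K} (ha : a ≠ 0) (s : ℕ) : IsUnit (jordanBlock a s) := by
  rw [Matrix.isUnit_iff_isUnit_det, Matrix.det_of_isUpperTriangular]
  · simp [jordanBlock, ha]
  · intro i j hij
    have : (j : ℕ) < i := hij
    simp only [jordanBlock, Matrix.of_apply]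
    rw [if_neg (by rintro rfl; omega), if_neg (by omega)]

theorem nullity_jordanBlock_sub_pow [DecidableEq K] (a b : K) (s i : ℕ) :
    nullity ((jordanBlock a s - b • (1 : Matrix (Fin s) (Fin s) K)) ^ i) =
      if a = b then min s i else 0 := by
  rw [jordanBlock_sub_scalar]
  split_ifs with h
  · rw [h, sub_self, nullity_jordanBlock_zero_pow]
  · exact nullity_eq_zero_of_isUnit ((isUnit_jordanBlock (sub_ne_zero.2 h) s).pow i)

theorem units_conj_sub_smul_pow {ι : Type*} [Fintype ι] [DecidableEq ι] (P : (Matrix ι ι K)ˣ)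
    (A : Matrix ι ι K) (b : K) (i : ℕ) :
    ((P : Matrix ι ι K) * A * ((P⁻¹ : (Matrix ι ι K)ˣ) : Matrix ι ι K) - b • 1) ^ i =
      (P : Matrix ι ι K) * (A - b • 1) ^ i * ((P⁻¹ : (Matrix ι ι K)ˣ) : Matrix ι ι K) := by
  rw [← Units.conj_pow]
  congr 1
  simp [mul_sub, sub_mul]

theorem submatrix_equiv_pow {ι κ : Type*} [Fintype ι] [DecidableEq ι] [Fintype κ] [DecidableEq κ]
    (A : Matrix κ κ K) (e : ι ≃ κ) (i : ℕ) :
    A.submatrix e e ^ i = (A ^ i).submatrix e e := by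
  induction i with
  | zero => simp
  | succ i ih => rw [pow_succ, ih, Matrix.submatrix_mul_equiv, pow_succ]

/-- Nullity is invariant under similarity and additive over blocks; blocks with eigenvalue other
than b become invertible and drop out. -/
theorem IsJordanForm.nullity_sub_pow [DecidableEq K] {ι : Type*} [Fintype ι] [DecidableEq ι]
    {A : Matrix ι ι K} {S : Multiset (K × ℕ)} (h : IsJordanForm A S) (b : K) (i : ℕ) :
    nullity ((A - b • (1 : Matrix ι ι K)) ^ i) =
      (S.map fun q => if q.1 = b then min q.2 i else 0).sum := by
  obtain ⟨m, c, rfl, -, e, P, hP⟩ := h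
  rw [← nullity_units_conj P, ← units_conj_sub_smul_pow, hP]
  have h1 : (Matrix.blockDiagonal' fun i => jordanBlock (c i).1 (c i).2).submatrix e e -
      b • (1 : Matrix ι ι K) =
      (Matrix.blockDiagonal' fun i => (jordanBlock (c i).1 (c i).2 - b • 1)).submatrix e e := by
    have h2 : (Matrix.blockDiagonal' fun i => (jordanBlock (c i).1 (c i).2 - b • 1)) =
        (Matrix.blockDiagonal' fun i => jordanBlock (c i).1 (c i).2) - b • 1 := by
      rw [← Matrix.blockDiagonal'_one, ← Matrix.blockDiagonal'_smul, ← Matrix.blockDiagonal'_sub]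
      rfl
    rw [h2, ← Matrix.submatrix_one_equiv e]
    rfl
  rw [h1, submatrix_equiv_pow]
  rw [← Matrix.blockDiagonal'_pow, nullity_submatrix_equiv, nullity_blockDiagonal',
    Multiset.map_map]
  simp only [Pi.pow_apply, nullity_jordanBlock_sub_pow]
  rfl

/-- As a function of i, min u i is linear except for a kink at i = u, so its second difference at s
+ 1 detects u = s + 1. -/
theorem two_mul_sum_min {K : Type*} [DecidableEq K] (S : Multiset (K × ℕ)) (b : K) (s : ℕ) :
    2 * (S.map fun q => if q.1 = b then min q.2 (s + 1) else 0).sum =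
      S.count (b, s + 1) + (S.map fun q => if q.1 = b then min q.2 s else 0).sum +
        (S.map fun q => if q.1 = b then min q.2 (s + 2) else 0).sum := by
  induction S using Multiset.induction with
  | empty => simp
  | cons q S ih =>
    obtain ⟨a, u⟩ := q
    simp only [Multiset.map_cons, Multiset.sum_cons, Multiset.count_cons, Prod.mk.injEq]
    by_cases hab : a = b
    · subst hab
      simp only [true_and, if_true]
      split_ifs <;> omega
    · simp only [if_neg hab, if_neg (fun h : b = a ∧ s + 1 = u => hab h.1.symm)]
      omega

theorem IsJordanForm.two_mul_nullity [DecidableEq K] {ι : Type*} [Fintype ι] [DecidableEq ι]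
    {A : Matrix ι ι K} {S : Multiset (K × ℕ)} (h : IsJordanForm A S) (b : K) (s : ℕ) :
    2 * nullity ((A - b • (1 : Matrix ι ι K)) ^ (s + 1)) =
      S.count (b, s + 1) + nullity ((A - b • (1 : Matrix ι ι K)) ^ s) +
        nullity ((A - b • (1 : Matrix ι ι K)) ^ (s + 2)) := by
  simp only [h.nullity_sub_pow, two_mul_sum_min]

/-- Blocks of size 0 are invisible to nullities; only the positivity clause excludes them. -/
theorem IsJordanForm.count_zero [DecidableEq K] {ι : Type*} [Fintype ι] [DecidableEq ι]
    {A : Matrix ι ι K} {S : Multiset (K × ℕ)} (h : IsJordanForm A S) (b : K) :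
    S.count (b, 0) = 0 := by
  obtain ⟨m, c, rfl, hpos, -⟩ := h
  rw [Multiset.count_eq_zero, Multiset.mem_map]
  rintro ⟨i, -, hi⟩
  have := hpos i
  rw [hi] at this
  exact lt_irrefl _ this

end JordanNullity

/-! ### Existence of a Jordan form for scalar plus nilpotent -/

section Existence

variable {K : Type*} [Field K]

/-- The basis of `K[X] / (X ^ s)` consisting of the powers of `X`, in decreasing order. -/
noncomputable def adjoinRootXPowBasis (K : Type*) [Field K] (s : ℕ) :
    Basis (Fin s) K (AdjoinRoot (Polynomial.X ^ s : Polynomial K)) :=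
  ((AdjoinRoot.powerBasis' (Polynomial.monic_X_pow (R := K) s)).basis.reindex
    (finCongr ((AdjoinRoot.powerBasis'_dim _).trans (Polynomial.natDegree_X_pow s)))).reindex
      Fin.revPerm

theorem adjoinRootXPowBasis_apply (s : ℕ) (j : Fin s) :
    adjoinRootXPowBasis K s j = AdjoinRoot.root _ ^ (s - 1 - (j : ℕ)) := by
  rw [adjoinRootXPowBasis, Basis.reindex_apply, Basis.reindex_apply, PowerBasis.basis_eq_pow,
    AdjoinRoot.powerBasis'_gen]
  congr 1
  simp [Fin.val_rev]
  omega

/-- A basis of `K[X] / (X ^ s)` on which multiplication by `X` shifts the indices down. -/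
noncomputable def quotXPowBasis (K : Type*) [Field K] (s : ℕ) :
    Basis (Fin s) K (Polynomial K ⧸ (Polynomial K ∙ (Polynomial.X ^ s : Polynomial K))) :=
  adjoinRootXPowBasis K s

theorem quotXPowBasis_apply (s : ℕ) (j : Fin s) :
    quotXPowBasis K s j = Submodule.Quotient.mk (Polynomial.X ^ (s - 1 - (j : ℕ))) :=
  (adjoinRootXPowBasis_apply s j).trans rfl

theorem dfinsuppBasis_apply {ι : Type*} [DecidableEq ι] {M : ι → Type*} [∀ i, AddCommGroup (M i)]
    [∀ i, Module K (M i)] {η : ι → Type*} (b : ∀ i, Basis (η i) K (M i)) (i : ι) (j : η i) :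
    DFinsupp.basis b ⟨i, j⟩ = DFinsupp.single i (b i j) := by
  classical
  rw [Basis.apply_eq_iff]
  simp [DFinsupp.basis, DFinsupp.mapRange_single, Equiv.symm_apply_eq,
    sigmaFinsuppEquivDFinsupp_single]

theorem X_smul_quotXPowBasis (s : ℕ) (j : Fin s) :
    (Polynomial.X : Polynomial K) • quotXPowBasis K s j =
      if h : 0 < (j : ℕ) then quotXPowBasis K s ⟨j - 1, by omega⟩ else 0 := by
  have hj := j.2
  rw [quotXPowBasis_apply, ← Submodule.Quotient.mk_smul, smul_eq_mul, ← pow_succ']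
  split_ifs with h
  · rw [quotXPowBasis_apply]
    congr 2
    simp only
    omega
  · rw [Submodule.Quotient.mk_eq_zero, show s - 1 - (j : ℕ) + 1 = s by omega]
    exact Submodule.mem_span_singleton_self _

/-- Let X act on V as f. Nilpotency makes V an X-power torsion module, hence a direct sum of modules
K[X]/(X^k), and each has a basis of powers of X. -/
theorem exists_jordan_basis_of_isNilpotent {V : Type*} [AddCommGroup V] [Module K V]
    [FiniteDimensional K V] (f : V →ₗ[K] V) (hf : IsNilpotent f) :
    ∃ (d : ℕ) (k : Fin d → ℕ) (B : Basis (Σ i, Fin (k i)) K V),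
      ∀ i (j : Fin (k i)), f (B ⟨i, j⟩) =
        if h : 0 < (j : ℕ) then B ⟨i, ⟨j - 1, by omega⟩⟩ else 0 := by
  obtain ⟨N, hN⟩ := hf
  have htors : Module.IsTorsion' (AEval' f) (Submonoid.powers (Polynomial.X : Polynomial K)) := by
    rw [Submodule.isTorsion'_powers_iff]
    intro x
    refine ⟨N, ?_⟩
    obtain ⟨v, rfl⟩ := (AEval'.of f).surjective x
    rw [AEval'.X_pow_smul_of, hN]
    simp
  obtain ⟨d, k, ⟨e⟩⟩ := Module.torsion_by_prime_power_decomposition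
    (Polynomial.irreducible_X (R := K)) htors
  let B : Basis (Σ i, Fin (k i)) K V :=
    (DFinsupp.basis fun i => quotXPowBasis K (k i)).map
      ((e.restrictScalars K).symm.trans (AEval'.of f).symm)
  have hB : ∀ i j, B ⟨i, j⟩ = (AEval'.of f).symm (e.symm
      (DirectSum.lof (Polynomial K) (Fin d) _ i (quotXPowBasis K (k i) j))) := by
    intro i j
    simp only [B, Basis.map_apply, dfinsuppBasis_apply]
    rfl
  refine ⟨d, k, B, fun i j => ?_⟩
  have h1 : f (B ⟨i, j⟩) = (AEval'.of f).symm (e.symm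
      (DirectSum.lof (Polynomial K) (Fin d) _ i
        ((Polynomial.X : Polynomial K) • quotXPowBasis K (k i) j))) := by
    rw [hB, map_smul, map_smul, AEval'.of_symm_X_smul]
  rw [h1, X_smul_quotXPowBasis]
  split_ifs with h
  · rw [hB]
  · simp

/-- The module decomposition may contain zero summands K[X]/(X^0); they carry no basis vectors and
are discarded. -/
theorem exists_jordan_basis_of_isNilpotent_pos {V : Type*} [AddCommGroup V] [Module K V]
    [FiniteDimensional K V] (f : V →ₗ[K] V) (hf : IsNilpotent f) :
    ∃ (d : ℕ) (k : Fin d → ℕ) (B : Basis (Σ i, Fin (k i)) K V), (∀ i, 0 < k i) ∧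
      ∀ i (j : Fin (k i)), f (B ⟨i, j⟩) =
        if h : 0 < (j : ℕ) then B ⟨i, ⟨j - 1, by omega⟩⟩ else 0 := by
  obtain ⟨d, k, B, hB⟩ := exists_jordan_basis_of_isNilpotent f hf
  let e : Fin (Fintype.card {i // 0 < k i}) ≃ {i // 0 < k i} := (Fintype.equivFin _).symm
  let g : (Σ i, Fin (k i)) ≃ Σ i, Fin (k (e i)) :=
    { toFun := fun x => ⟨e.symm ⟨x.1, x.2.pos⟩, Fin.cast (by simp) x.2⟩
      invFun := fun x => ⟨e x.1, x.2⟩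
      left_inv := by
        rintro ⟨i, j⟩
        ext
        · simp
        · simp only
          rw! [Equiv.apply_symm_apply]
          rfl
      right_inv := by
        rintro ⟨i, j⟩
        ext
        · simp
        · simp only
          rw! [Equiv.symm_apply_apply]
          rfl }
  refine ⟨_, fun i => k (e i), B.reindex g, fun i => (e i).2, fun i j => ?_⟩
  simp only [Basis.reindex_apply]
  exact hB _ _

theorem exists_isJordanForm {ι : Type*} [Fintype ι] [DecidableEq ι] (A : Matrix ι ι K) (a : K)
    (hA : IsNilpotent (A - a • (1 : Matrix ι ι K))) : ∃ S, IsJordanForm A S := by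
  obtain ⟨d, k, B, hk, hB⟩ := exists_jordan_basis_of_isNilpotent_pos
    (Matrix.toLin' (A - a • 1)) (hA.map Matrix.toLinAlgEquiv')
  let e : ι ≃ Σ i, Fin (k i) := (Pi.basisFun K ι).indexEquiv B
  let B' : Basis ι K (ι → K) := B.reindex e.symm
  let P : (Matrix ι ι K)ˣ :=
    ⟨B'.toMatrix (Pi.basisFun K ι), (Pi.basisFun K ι).toMatrix B',
      B'.toMatrix_mul_toMatrix_flip _, (Pi.basisFun K ι).toMatrix_mul_toMatrix_flip _⟩
  refine ⟨_, d, fun i => (a, k i), rfl, hk, e, P, ?_⟩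
  have h1 : (P : Matrix ι ι K) * A * ((P⁻¹ : (Matrix ι ι K)ˣ) : Matrix ι ι K) =
      LinearMap.toMatrix B' B' (Matrix.toLin' A) := by
    rw [← basis_toMatrix_mul_linearMap_toMatrix_mul_basis_toMatrix B' (Pi.basisFun K ι) B'
      (Pi.basisFun K ι), LinearMap.toMatrix_eq_toMatrix', LinearMap.toMatrix'_toLin']
    rfl
  rw [h1]
  have h2 : ∀ i (j : Fin (k i)), Matrix.toLin' A (B ⟨i, j⟩) = a • B ⟨i, j⟩ +
      if h : 0 < (j : ℕ) then B ⟨i, ⟨j - 1, by omega⟩⟩ else 0 := by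
    intro i j
    rw [← hB]
    simp
  ext x y
  rw [LinearMap.toMatrix_apply, Matrix.submatrix_apply]
  simp only [B', Basis.reindex_apply, Basis.repr_reindex, Equiv.symm_symm,
    Finsupp.mapDomain_equiv_apply]
  generalize e x = x'
  generalize e y = y'
  obtain ⟨i, j⟩ := x'
  obtain ⟨i', j'⟩ := y'
  rw [h2]
  by_cases hi : i = i'
  · subst hi
    rw [Matrix.blockDiagonal'_apply_eq]
    simp only [jordanBlock, Matrix.of_apply, map_add, map_smul, Finsupp.add_apply,
      Finsupp.smul_apply, Basis.repr_self, Finsupp.single_apply, Sigma.mk.injEq, heq_eq_eq,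
      true_and, eq_comm (a := j')]
    split_ifs with h3 h4 h4 h4 h4 <;> simp [Finsupp.single_apply, Fin.ext_iff] <;> omega
  · rw [Matrix.blockDiagonal'_apply_ne _ _ _ hi]
    have hi' : ¬ i' = i := fun h => hi h.symm
    split_ifs <;> simp [hi']

end Existence

/-! ### Commutation identities of sl₂ -/

section Sl2

theorem sl2_H_mul_pow {R : Type*} [Ring R] {E H : R} (hHE : H * E = E * H + 2 • E) (m : ℕ) :
    H * E ^ m = E ^ m * H + (2 * m) • E ^ m := by
  induction m with
  | zero => simp
  | succ m ih =>
    rw [pow_succ, ← mul_assoc, ih, add_mul, mul_assoc, hHE]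
    simp only [mul_add, mul_assoc, smul_mul_assoc, mul_smul_comm, mul_one, add_smul]
    abel

theorem sl2_pow_mul_F {R : Type*} [Ring R] {E F H : R} (hEF : E * F = F * E + H)
    (hHE : H * E = E * H + 2 • E) (m : ℕ) :
    E ^ (m + 1) * F = F * E ^ (m + 1) + (m + 1) • (E ^ m * H) + ((m + 1) * m) • E ^ m := by
  induction m with
  | zero => simp [hEF]
  | succ m ih =>
    rw [pow_succ' E (m + 1), mul_assoc, ih, mul_add, mul_add, ← mul_assoc, hEF, add_mul, mul_assoc,
      ← pow_succ', sl2_H_mul_pow hHE, mul_smul_comm, mul_smul_comm, ← mul_assoc, ← pow_succ']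
    have h1 : (2 * (m + 1)) • E ^ (m + 1) + ((m + 1) * m) • E ^ (m + 1) =
      ((m + 1 + 1) * (m + 1)) • E ^ (m + 1) := by
      rw [← add_smul]
      congr 1
      ring
    rw [← h1, add_smul (m + 1) 1, one_smul]
    abel

end Sl2

/-! ### Graded sl₂ action and filtered perturbations of E -/

section Graded

theorem mulVec_apply_eq_sum {K : Type*} [Field K] {ι : Type*} [Fintype ι] (A : Matrix ι ι K)
    (v : ι → K) (x : ι) : A.mulVec v x = ∑ y, A x y * v y := rfl

variable {K : Type*} [Field K] {ι : Type*} [Fintype ι] [DecidableEq ι]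

theorem graded_pow_apply_eq_zero {deg : ι → ℕ} {E : Matrix ι ι K}
    (hE : ∀ x y, deg y ≠ deg x + 1 → E x y = 0) (m : ℕ) (x y : ι) (h : deg y ≠ deg x + m) :
    (E ^ m) x y = 0 := by
  induction m generalizing x with
  | zero =>
    rw [pow_zero, Matrix.one_apply_ne]
    rintro rfl
    simp at h
  | succ m ih =>
    rw [pow_succ', Matrix.mul_apply]
    refine Finset.sum_eq_zero fun z _ => ?_
    by_cases hz : deg z = deg x + 1
    · rw [ih z (by omega), mul_zero]
    · rw [hE x z hz, zero_mul]

theorem graded_pow_mulVec_mem {deg : ι → ℕ} {E : Matrix ι ι K}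
    (hE : ∀ x y, deg y ≠ deg x + 1 → E x y = 0) (m d : ℕ) {v : ι → K}
    (hv : v ∈ coordSubspace K fun x => deg x = d + m) :
    (E ^ m).mulVec v ∈ coordSubspace K fun x => deg x = d := by
  intro x hx
  rw [mulVec_apply_eq_sum]
  refine Finset.sum_eq_zero fun y _ => ?_
  by_cases hy : deg y = d + m
  · rw [graded_pow_apply_eq_zero hE m x y (by omega), zero_mul]
  · rw [hv y hy, mul_zero]

/-- Double induction, downward on the degree k and upward on m. If E^(m+1) v = 0, then E^(m+2) kills
F v, so F v = 0 by the case k + 1. Commuting F past E^(m+1) then leaves a multiple of E^m v with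
coefficient (m + 1)(n - 2k + m), nonzero in characteristic 0 because n + m < 2k. -/
theorem graded_pow_mulVec_injective [CharZero K] {deg : ι → ℕ} {n : ℕ} (hdeg : ∀ x, deg x ≤ n)
    {E F : Matrix ι ι K} (hE : ∀ x y, deg y ≠ deg x + 1 → E x y = 0)
    (hF : ∀ x y, deg x ≠ deg y + 1 → F x y = 0)
    (hEF : E * F - F * E = Matrix.diagonal fun x => (n : K) - 2 * deg x)
    {k m : ℕ} (hmk : m + n ≤ 2 * k) {v : ι → K} (hv : v ∈ coordSubspace K fun x => deg x = k)
    (h0 : (E ^ m).mulVec v = 0) : v = 0 := by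
  set H : Matrix ι ι K := Matrix.diagonal fun x => (n : K) - 2 * deg x with hH
  have hEF' : E * F = F * E + H := by rw [← hEF]; abel
  have hHE : H * E = E * H + 2 • E := by
    ext x y
    simp only [hH, Matrix.diagonal_mul, Matrix.mul_diagonal, Matrix.add_apply,
      two_nsmul]
    by_cases h : deg y = deg x + 1
    · rw [h]; push_cast; ring
    · rw [hE x y h]; ring
  have hHv : ∀ (k : ℕ) (v : ι → K), (v ∈ coordSubspace K fun x => deg x = k) →
      H.mulVec v = ((n : K) - 2 * k) • v := by
    intro k v hv
    ext x
    rw [hH, Matrix.mulVec_diagonal, Pi.smul_apply, smul_eq_mul]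
    by_cases hx : deg x = k
    · rw [hx]
    · rw [hv x hx, mul_zero, mul_zero]
  have key : ∀ (k : ℕ) (v : ι → K), (v ∈ coordSubspace K fun x => deg x = k) → ∀ m : ℕ,
      (E ^ (m + 1)).mulVec (F.mulVec v) = F.mulVec ((E ^ (m + 1)).mulVec v) +
        (((m : K) + 1) * ((n : K) - 2 * k + m)) • (E ^ m).mulVec v := by
    intro k v hv m
    rw [Matrix.mulVec_mulVec, sl2_pow_mul_F hEF' hHE, Matrix.add_mulVec, Matrix.add_mulVec,
      ← Matrix.mulVec_mulVec, Matrix.smul_mulVec, Matrix.smul_mulVec, ← Matrix.mulVec_mulVec,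
      hHv k v hv, Matrix.mulVec_smul, ← Nat.cast_smul_eq_nsmul K, ← Nat.cast_smul_eq_nsmul K,
      smul_smul, add_assoc, ← add_smul]
    congr 2
    push_cast
    ring
  -- Here j bounds the distance from k to n + 1, where there are no coordinates left; induction on j
  -- is descent in k.
  suffices H : ∀ j k : ℕ, n + 1 ≤ k + j → ∀ (m : ℕ) (v : ι → K), m + n ≤ 2 * k →
      (v ∈ coordSubspace K fun x => deg x = k) → (E ^ m).mulVec v = 0 → v = 0 from
    H (n + 1) k (by omega) m v hmk hv h0
  intro j
  induction j with
  | zero =>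
    intro k hk m v _ hv _
    ext x
    exact hv x (by have := hdeg x; omega)
  | succ j ihj =>
    intro k hk m
    induction m with
    | zero =>
      intro v _ _ h0
      simpa using h0
    | succ m ihm =>
      intro v hmk hv h0
      have hFv : F.mulVec v ∈ coordSubspace K fun x => deg x = k + 1 := by
        intro x hx
        rw [mulVec_apply_eq_sum]
        refine Finset.sum_eq_zero fun y _ => ?_
        by_cases hy : deg y = k
        · rw [hF x y (by omega), zero_mul]
        · rw [hv y hy, mul_zero]
      have hFv0 : F.mulVec v = 0 := by
        refine ihj (k + 1) (by omega) (m + 2) _ (by omega) hFv ?_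
        rw [key k v hv (m + 1), h0, pow_succ' E (m + 1), ← Matrix.mulVec_mulVec, h0]
        simp
      have h1 := key k v hv m
      rw [hFv0, h0, Matrix.mulVec_zero, Matrix.mulVec_zero, zero_add, eq_comm,
        smul_eq_zero] at h1
      refine ihm v (by omega) hv (h1.resolve_left (mul_ne_zero (by exact_mod_cast m.succ_ne_zero) ?_))
      intro h
      have h2 : ((n + m : ℕ) : K) = ((2 * k : ℕ) : K) := by
        push_cast
        linear_combination h
      have := Nat.cast_injective h2
      omega

/-- E^(n - 2d) from degree n - d to degree d is injective between spaces of equal dimension, hence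
onto. It factors as E^i after E^(n - 2d - i). -/
theorem graded_pow_mulVec_surjective [CharZero K] {deg : ι → ℕ} {n : ℕ} (hdeg : ∀ x, deg x ≤ n)
    {E F : Matrix ι ι K} (hE : ∀ x y, deg y ≠ deg x + 1 → E x y = 0)
    (hF : ∀ x y, deg x ≠ deg y + 1 → F x y = 0)
    (hEF : E * F - F * E = Matrix.diagonal fun x => (n : K) - 2 * deg x)
    (hsymm : ∀ d ≤ n, (Finset.univ.filter fun x => deg x = n - d).card =
      (Finset.univ.filter fun x => deg x = d).card)
    {d i : ℕ} (hdi : 2 * d + i ≤ n) {w : ι → K} (hw : w ∈ coordSubspace K fun x => deg x = d) :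
    ∃ v ∈ coordSubspace K (fun x => deg x = d + i), (E ^ i).mulVec v = w := by
  have hmaps : ∀ v ∈ coordSubspace K (fun x => deg x = n - d),
      (E ^ (n - 2 * d)).mulVecLin v ∈ coordSubspace K (fun x => deg x = d) := fun v hv =>
    graded_pow_mulVec_mem hE _ d (by rwa [show d + (n - 2 * d) = n - d by omega])
  have hinj : Function.Injective ((E ^ (n - 2 * d)).mulVecLin.restrict hmaps) := by
    rw [← LinearMap.ker_eq_bot, LinearMap.ker_eq_bot']
    intro v hv
    exact Subtype.ext (graded_pow_mulVec_injective hdeg hE hF hEF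
      (k := n - d) (m := n - 2 * d) (by omega) v.2 (congrArg Subtype.val hv))
  have hsurj := (LinearMap.injective_iff_surjective_of_finrank_eq_finrank (by
    rw [finrank_coordSubspace, finrank_coordSubspace, hsymm d (by omega)])).1 hinj
  obtain ⟨u, hu⟩ := hsurj ⟨w, hw⟩
  refine ⟨(E ^ (n - 2 * d - i)).mulVec u, graded_pow_mulVec_mem hE _ _ ?_, ?_⟩
  · rw [show d + i + (n - 2 * d - i) = n - d by omega]
    exact u.2
  · rw [Matrix.mulVec_mulVec, ← pow_add, show i + (n - 2 * d - i) = n - 2 * d by omega]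
    exact congrArg Subtype.val hu

/-- If `M` lowers the degree filtration and has leading part `E`, then `M ^ i` has leading part
`E ^ i`. -/
theorem filtered_pow_apply {deg : ι → ℕ} {M E : Matrix ι ι K}
    (hE : ∀ x y, deg y ≠ deg x + 1 → E x y = 0)
    (hM : ∀ x y, deg y ≤ deg x + 1 → M x y = E x y) (i : ℕ) (x y : ι)
    (h : deg y ≤ deg x + i) : (M ^ i) x y = (E ^ i) x y := by
  induction i generalizing x with
  | zero => simp
  | succ i ih =>
    rw [pow_succ', pow_succ', Matrix.mul_apply, Matrix.mul_apply]
    refine Finset.sum_congr rfl fun z _ => ?_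
    rcases lt_trichotomy (deg z) (deg x + 1) with hz | hz | hz
    · rw [hM x z hz.le, hE x z hz.ne, zero_mul, zero_mul]
    · rw [hM x z hz.le, ih z (by omega)]
    · rw [hE x z hz.ne', ih z (by omega),
        graded_pow_apply_eq_zero hE i z y (by omega), mul_zero, mul_zero]

theorem filtered_pow_eq_zero {deg : ι → ℕ} {n : ℕ} (hdeg : ∀ x, deg x ≤ n) {M E : Matrix ι ι K}
    (hE : ∀ x y, deg y ≠ deg x + 1 → E x y = 0)
    (hM : ∀ x y, deg y ≤ deg x + 1 → M x y = E x y) : M ^ (n + 1) = 0 := by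
  ext x y
  have := hdeg y
  rw [filtered_pow_apply hE hM _ x y (by omega), graded_pow_apply_eq_zero hE _ x y (by omega),
    Matrix.zero_apply]

/-- Rank-nullity for f restricted to the preimage of W, which contains the kernel and maps onto W.
-/
theorem finrank_comap_of_le_range {V V' : Type*} [AddCommGroup V] [Module K V]
    [FiniteDimensional K V] [AddCommGroup V'] [Module K V'] (f : V →ₗ[K] V') (W : Submodule K V')
    (hW : W ≤ LinearMap.range f) :
    finrank K (LinearMap.ker f) + finrank K W = finrank K (W.comap f) := by
  have h := LinearMap.finrank_range_add_finrank_ker (f.domRestrict (W.comap f))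
  rw [LinearMap.range_domRestrict, Submodule.map_comap_eq_of_le hW, LinearMap.ker_domRestrict,
    (Submodule.comapSubtypeEquivOfLe (LinearMap.ker_le_comap f)).finrank_eq] at h
  omega

theorem nullity_filtered_pow [CharZero K] {deg : ι → ℕ} {n : ℕ} (hdeg : ∀ x, deg x ≤ n)
    {M E F : Matrix ι ι K} (hE : ∀ x y, deg y ≠ deg x + 1 → E x y = 0)
    (hF : ∀ x y, deg x ≠ deg y + 1 → F x y = 0)
    (hEF : E * F - F * E = Matrix.diagonal fun x => (n : K) - 2 * deg x)
    (hsymm : ∀ d ≤ n, (Finset.univ.filter fun x => deg x = n - d).card =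
      (Finset.univ.filter fun x => deg x = d).card)
    (hM : ∀ x y, deg y ≤ deg x + 1 → M x y = E x y) (i : ℕ) :
    nullity (M ^ i) + (Finset.univ.filter fun x => 2 * deg x + i ≤ n).card =
      (Finset.univ.filter fun x => 2 * deg x ≤ n + i).card := by
  have hW : coordSubspace K (fun x => 2 * deg x + i ≤ n) ≤ LinearMap.range (M ^ i).mulVecLin := by
    suffices H : ∀ d : ℕ, ∀ f : ι → K, f ∈ coordSubspace K (fun x => 2 * deg x + i ≤ n) →
        f ∈ coordSubspace K (fun x => deg x < d) → f ∈ LinearMap.range (M ^ i).mulVecLin from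
      fun f hf => H (n + 1) f hf fun x hx => absurd (hdeg x) (by omega)
    intro d
    induction d with
    | zero =>
      intro f _ hf
      rw [show f = 0 from funext fun x => hf x (by omega)]
      exact Submodule.zero_mem _
    | succ d ih =>
      intro f hf hfd
      -- Lift the top-degree component of f through E^i. Applying M^i to the lift changes it only in
      -- lower degrees, so the difference falls to the induction hypothesis.
      by_cases hdi : 2 * d + i ≤ n
      · obtain ⟨v, hv, hvw⟩ := graded_pow_mulVec_surjective hdeg hE hF hEF hsymm hdi
          (w := fun x => if deg x = d then f x else 0) (fun x hx => if_neg hx)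
        have hQ : ∀ x, d ≤ deg x → (M ^ i).mulVec v x = if deg x = d then f x else 0 := by
          intro x hx
          rw [← congrFun hvw x, mulVec_apply_eq_sum, mulVec_apply_eq_sum]
          refine Finset.sum_congr rfl fun y _ => ?_
          by_cases hy : deg y = d + i
          · rw [filtered_pow_apply hE hM i x y (by omega)]
          · rw [hv y hy, mul_zero, mul_zero]
        have hsub : f - (M ^ i).mulVec v ∈ coordSubspace K (fun x => deg x < d) := by
          intro x hx
          rw [Pi.sub_apply, hQ x (by omega)]
          split_ifs with h
          · exact sub_self _
          · rw [hfd x (by omega), sub_zero]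
        have := ih _ (fun x hx => hsub x (by omega)) hsub
        rw [← sub_add_cancel f ((M ^ i).mulVec v)]
        exact Submodule.add_mem _ this ⟨v, rfl⟩
      · refine ih f hf fun x hx => ?_
        by_cases h : deg x = d
        · exact hf x (by omega)
        · exact hfd x (by omega)
  have hU : (coordSubspace K (fun x => 2 * deg x + i ≤ n)).comap (M ^ i).mulVecLin =
      coordSubspace K (fun x => 2 * deg x ≤ n + i) := by
    refine le_antisymm (fun f hf => ?_) (fun f hf x hx => ?_)
    · replace hf : ∀ x, ¬ (2 * deg x + i ≤ n) → (M ^ i).mulVec f x = 0 := hf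
      -- Remove the degrees of f from the top down. When those above k vanish, the degree k - i part
      -- of M^i f is E^i of the degree k part of f. It vanishes since 2(k - i) + i > n, and E^i is
      -- injective on degree k.
      suffices H : ∀ j k : ℕ, n + 1 ≤ k + j → n + i < 2 * k → ∀ x, k ≤ deg x → f x = 0 from
        fun x hx => H (n + 1) (deg x) (by omega) (by omega) x le_rfl
      intro j
      induction j with
      | zero =>
        intro k hk _ x hx
        have := hdeg x
        omega
      | succ j ih =>
        intro k hk hki
        have hgt := ih (k + 1) (by omega) (by omega)
        have hg : (fun x => if deg x = k then f x else 0) = (0 : ι → K) := by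
          refine graded_pow_mulVec_injective hdeg hE hF hEF (k := k) (m := i) (by omega)
            (fun x hx => if_neg hx) ?_
          ext x
          by_cases hx : deg x + i = k
          · refine Eq.trans ?_ (hf x (by omega))
            rw [mulVec_apply_eq_sum, mulVec_apply_eq_sum]
            refine Finset.sum_congr rfl fun y _ => ?_
            rcases lt_trichotomy (deg y) k with hy | hy | hy
            · rw [if_neg hy.ne, filtered_pow_apply hE hM i x y (by omega),
                graded_pow_apply_eq_zero hE i x y (by omega), mul_zero, zero_mul]
            · rw [if_pos hy, filtered_pow_apply hE hM i x y (by omega)]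
            · rw [if_neg hy.ne', hgt y hy, mul_zero, mul_zero]
          · rw [mulVec_apply_eq_sum]
            refine Finset.sum_eq_zero fun y _ => ?_
            by_cases hy : deg y = k
            · rw [graded_pow_apply_eq_zero hE i x y (by omega), zero_mul]
            · rw [if_neg hy, mul_zero]
        intro x hx
        by_cases h : deg x = k
        · have := congrFun hg x
          simpa [h] using this
        · exact hgt x (by omega)
    · rw [Matrix.mulVecLin_apply, mulVec_apply_eq_sum]
      refine Finset.sum_eq_zero fun y _ => ?_
      by_cases hy : 2 * deg y ≤ n + i
      · rw [filtered_pow_apply hE hM i x y (by omega),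
          graded_pow_apply_eq_zero hE i x y (by omega), zero_mul]
      · rw [hf y hy, mul_zero]
  have h := finrank_comap_of_le_range _ _ hW
  rwa [hU, finrank_coordSubspace, finrank_coordSubspace] at h

end Graded

/-! ### The sl₂-triple of one Jordan block -/

section SingleBlock

variable {K : Type*} [Field K]

/-- The raising operator that completes the nilpotent Jordan block to an `sl₂`-triple. -/
def raisingMatrix (K : Type*) [Field K] (s : ℕ) : Matrix (Fin s) (Fin s) K :=
  Matrix.of fun x y => if (y : ℕ) + 1 = x then (((y : ℕ) : K) + 1) * ((s : K) - 1 - (y : ℕ)) else 0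

theorem jordanBlock_zero_apply (s : ℕ) (x y : Fin s) :
    jordanBlock (0 : K) s x y = if (x : ℕ) + 1 = y then 1 else 0 := by
  have := jordanBlock_zero_pow_apply (K := K) s 1 x y
  rwa [pow_one] at this

theorem jordanBlock_mul_raisingMatrix (s : ℕ) : jordanBlock (0 : K) s * raisingMatrix K s =
    Matrix.diagonal fun x : Fin s => (((x : ℕ) : K) + 1) * ((s : K) - 1 - (x : ℕ)) := by
  ext x y
  rw [Matrix.mul_apply, Matrix.diagonal_apply]
  simp only [jordanBlock_zero_apply, raisingMatrix, Matrix.of_apply]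
  by_cases hx : (x : ℕ) + 1 < s
  · rw [Finset.sum_eq_single ⟨x + 1, hx⟩]
    · by_cases h : x = y
      · simp [h]
      · simp [h, Fin.ext_iff.not.1 (Ne.symm h)]
    · intro z _ hz
      rw [if_neg (fun h => hz (Fin.ext h.symm)), zero_mul]
    · simp
  -- At the last index the product has no term, and the coefficient s - 1 - x is zero as well.
  · have hs : (s : K) = (x : ℕ) + 1 := by
      rw [← Nat.cast_add_one]
      congr 1
      omega
    rw [Finset.sum_eq_zero, hs]
    · simp
    · intro z _
      rw [if_neg (by omega), zero_mul]

theorem raisingMatrix_mul_jordanBlock (s : ℕ) : raisingMatrix K s * jordanBlock (0 : K) s =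
    Matrix.diagonal fun x : Fin s => ((x : ℕ) : K) * ((s : K) - (x : ℕ)) := by
  ext x y
  rw [Matrix.mul_apply, Matrix.diagonal_apply]
  simp only [jordanBlock_zero_apply, raisingMatrix, Matrix.of_apply]
  by_cases hx : 0 < (x : ℕ)
  · obtain ⟨u, hu⟩ : ∃ u, (x : ℕ) = u + 1 := ⟨x - 1, by omega⟩
    rw [Finset.sum_eq_single ⟨u, by omega⟩]
    · by_cases h : x = y
      · subst h
        simp only [hu, if_true, mul_one]
        push_cast
        ring
      · have : ¬ (u + 1 = (y : ℕ)) := fun h' => h (Fin.ext (by omega))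
        simp [h, this]
    · intro z _ hz
      rw [if_neg (fun h => hz (Fin.ext (by simp; omega))), zero_mul]
    · simp
  · have hs : (x : ℕ) = 0 := by omega
    rw [Finset.sum_eq_zero, hs]
    · simp
    · intro z _
      rw [if_neg (by omega), zero_mul]

theorem jordanBlock_raisingMatrix_commutator (s : ℕ) :
    jordanBlock (0 : K) s * raisingMatrix K s - raisingMatrix K s * jordanBlock (0 : K) s =
      Matrix.diagonal fun x : Fin s => (s : K) - 1 - 2 * (x : ℕ) := by
  rw [jordanBlock_mul_raisingMatrix, raisingMatrix_mul_jordanBlock, Matrix.diagonal_sub]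
  congr 1
  ext x
  ring

end SingleBlock

/-! ### Operators on the tensor product and the degree of tuples -/

section Tensor

variable {K : Type*} [Field K] {t : ℕ} {r : Fin t → ℕ}

theorem tensorMatrix_mul (A B : (j : Fin t) → Matrix (Fin (r j)) (Fin (r j)) K) :
    tensorMatrix A * tensorMatrix B = tensorMatrix fun j => A j * B j := by
  ext x y
  simp only [tensorMatrix, Matrix.mul_apply, Matrix.of_apply, Finset.prod_univ_sum,
    Fintype.piFinset_univ, Finset.prod_mul_distrib]

/-- The operator acting as `B` on the `j`-th tensor factor and as the identity on the others. -/
def factorMatrix (j : Fin t) (B : Matrix (Fin (r j)) (Fin (r j)) K) :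
    Matrix ((j : Fin t) → Fin (r j)) ((j : Fin t) → Fin (r j)) K :=
  tensorMatrix (Function.update (fun _ => 1) j B)

theorem factorMatrix_apply (j : Fin t) (B : Matrix (Fin (r j)) (Fin (r j)) K)
    (x y : (j : Fin t) → Fin (r j)) :
    factorMatrix j B x y =
      B (x j) (y j) * ∏ i ∈ Finset.univ.erase j, if x i = y i then 1 else 0 := by
  rw [factorMatrix, tensorMatrix, Matrix.of_apply,
    ← Finset.mul_prod_erase _ _ (Finset.mem_univ j), Function.update_self]
  congr 1
  refine Finset.prod_congr rfl fun i hi => ?_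
  rw [Function.update_of_ne (Finset.ne_of_mem_erase hi), Matrix.one_apply]

theorem factorMatrix_apply_of_forall (j : Fin t) (B : Matrix (Fin (r j)) (Fin (r j)) K)
    (x y : (j : Fin t) → Fin (r j)) (h : ∀ i, i ≠ j → x i = y i) :
    factorMatrix j B x y = B (x j) (y j) := by
  rw [factorMatrix_apply, Finset.prod_eq_one, mul_one]
  intro i hi
  rw [if_pos (h i (Finset.ne_of_mem_erase hi))]

theorem factorMatrix_apply_of_ne (j : Fin t) (B : Matrix (Fin (r j)) (Fin (r j)) K)
    (x y : (j : Fin t) → Fin (r j)) (i : Fin t) (hi : i ≠ j) (h : x i ≠ y i) :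
    factorMatrix j B x y = 0 := by
  rw [factorMatrix_apply, Finset.prod_eq_zero (Finset.mem_erase.2 ⟨hi, Finset.mem_univ i⟩)
    (if_neg h), mul_zero]

theorem factorMatrix_sub (j : Fin t) (B C : Matrix (Fin (r j)) (Fin (r j)) K) :
    factorMatrix j (B - C) = factorMatrix j B - factorMatrix j C := by
  ext x y
  simp only [Matrix.sub_apply, factorMatrix_apply, sub_mul]

theorem factorMatrix_mul (j : Fin t) (B C : Matrix (Fin (r j)) (Fin (r j)) K) :
    factorMatrix j B * factorMatrix j C = factorMatrix j (B * C) := by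
  rw [factorMatrix, factorMatrix, factorMatrix, tensorMatrix_mul]
  congr 1
  ext1 i
  by_cases h : i = j
  · subst h; simp
  · simp [h]

theorem factorMatrix_commute {j l : Fin t} (hjl : j ≠ l) (B : Matrix (Fin (r j)) (Fin (r j)) K)
    (C : Matrix (Fin (r l)) (Fin (r l)) K) :
    factorMatrix j B * factorMatrix l C = factorMatrix l C * factorMatrix j B := by
  rw [factorMatrix, factorMatrix, tensorMatrix_mul, tensorMatrix_mul]
  congr 1
  ext1 i
  by_cases h : i = j
  · subst h; simp [hjl]
  · simp [h]

theorem factorMatrix_diagonal (j : Fin t) (h : Fin (r j) → K) :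
    factorMatrix j (Matrix.diagonal h) = Matrix.diagonal fun x => h (x j) := by
  ext x y
  by_cases hxy : x = y
  · subst hxy
    rw [factorMatrix_apply_of_forall _ _ _ _ fun _ _ => rfl]
    simp
  · rw [Matrix.diagonal_apply_ne _ hxy]
    obtain ⟨i, hi⟩ := Function.ne_iff.1 hxy
    by_cases hij : i = j
    · subst hij
      rw [factorMatrix_apply, Matrix.diagonal_apply_ne _ hi, zero_mul]
    · exact factorMatrix_apply_of_ne j _ x y i hij hi

/-- The total degree of a multi-index. -/
def tupleDegree (x : (j : Fin t) → Fin (r j)) : ℕ := ∑ j, (x j : ℕ)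

theorem tupleDegree_eq_add_one {x y : (j : Fin t) → Fin (r j)} (j : Fin t)
    (h : ∀ i, i ≠ j → x i = y i) (hj : (x j : ℕ) + 1 = y j) :
    tupleDegree y = tupleDegree x + 1 := by
  rw [tupleDegree, tupleDegree, ← Finset.add_sum_erase _ _ (Finset.mem_univ j),
    ← Finset.add_sum_erase _ (fun i => (x i : ℕ)) (Finset.mem_univ j), ← hj,
    Finset.sum_congr rfl fun i hi => by rw [← h i (Finset.ne_of_mem_erase hi)]]
  omega

/-- The leading part of `⨂ J(α j, r j) - ∏ α j`: it lowers the degree by one. -/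
def loweringSum (α : Fin t → K) : Matrix ((j : Fin t) → Fin (r j)) ((j : Fin t) → Fin (r j)) K :=
  ∑ j, (∏ i ∈ Finset.univ.erase j, α i) • factorMatrix j (jordanBlock (0 : K) (r j))

/-- The raising operator that completes `loweringSum` to an `sl₂`-triple. -/
def raisingSum (α : Fin t → K) : Matrix ((j : Fin t) → Fin (r j)) ((j : Fin t) → Fin (r j)) K :=
  ∑ j, (∏ i ∈ Finset.univ.erase j, α i)⁻¹ • factorMatrix j (raisingMatrix K (r j))

theorem loweringSum_apply (α : Fin t → K) (x y : (j : Fin t) → Fin (r j)) :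
    loweringSum α x y = ∑ j, (∏ i ∈ Finset.univ.erase j, α i) *
      factorMatrix j (jordanBlock (0 : K) (r j)) x y := by
  simp [loweringSum, Matrix.sum_apply]

theorem loweringSum_apply_eq_zero (α : Fin t → K) (x y : (j : Fin t) → Fin (r j))
    (h : tupleDegree y ≠ tupleDegree x + 1) : loweringSum α x y = 0 := by
  rw [loweringSum_apply]
  refine Finset.sum_eq_zero fun j _ => ?_
  by_cases hx : ∀ i, i ≠ j → x i = y i
  · rw [factorMatrix_apply, jordanBlock_zero_apply,
      if_neg fun hj => h (tupleDegree_eq_add_one j hx hj), zero_mul, mul_zero]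
  · push Not at hx
    obtain ⟨i, hi, hxi⟩ := hx
    rw [factorMatrix_apply_of_ne j _ x y i hi hxi, mul_zero]

theorem raisingSum_apply_eq_zero (α : Fin t → K) (x y : (j : Fin t) → Fin (r j))
    (h : tupleDegree x ≠ tupleDegree y + 1) : raisingSum α x y = 0 := by
  simp only [raisingSum, Matrix.sum_apply, Matrix.smul_apply, smul_eq_mul]
  refine Finset.sum_eq_zero fun j _ => ?_
  by_cases hx : ∀ i, i ≠ j → x i = y i
  · rw [factorMatrix_apply, raisingMatrix, Matrix.of_apply,
      if_neg fun hj => h (tupleDegree_eq_add_one j (fun i hi => (hx i hi).symm) hj),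
      zero_mul, mul_zero]
  · push Not at hx
    obtain ⟨i, hi, hxi⟩ := hx
    rw [factorMatrix_apply_of_ne j _ x y i hi hxi, mul_zero]

theorem diagonal_finset_sum {ι κ : Type*} [DecidableEq ι] (s : Finset κ) (f : κ → ι → K) :
    ∑ j ∈ s, Matrix.diagonal (f j) = Matrix.diagonal fun x => ∑ j ∈ s, f j x := by
  ext x y
  rw [Matrix.sum_apply]
  by_cases h : x = y
  · subst h; simp
  · simp [h]

/-- Operators on different factors commute, so only equal indices contribute. There the weights of E
and F are mutually inverse, and the single-block commutators r_j - 1 - 2x_j add up. -/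
theorem loweringSum_raisingSum_commutator (α : Fin t → K) (hα : ∀ j, α j ≠ 0) (n : ℕ)
    (hn : (n : ℤ) = (∑ j, (r j : ℤ)) - t) :
    (loweringSum α : Matrix ((j : Fin t) → Fin (r j)) _ K) * raisingSum α -
      raisingSum α * loweringSum α =
      Matrix.diagonal fun x => (n : K) - 2 * tupleDegree x := by
  have hγ : ∀ j : Fin t, (∏ i ∈ Finset.univ.erase j, α i) ≠ 0 := fun j =>
    Finset.prod_ne_zero_iff.2 fun i _ => hα i
  rw [loweringSum, raisingSum, Finset.sum_mul_sum, Finset.sum_mul_sum]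
  -- Both double sums are now indexed with the lowering factor outside, so they subtract termwise.
  rw [Finset.sum_comm (f := fun j l => (_ • factorMatrix j (raisingMatrix K (r j))) * _),
    ← Finset.sum_sub_distrib]
  have h1 : ∀ j l : Fin t, l ≠ j →
      ((∏ i ∈ Finset.univ.erase j, α i) • factorMatrix j (jordanBlock (0 : K) (r j))) *
        ((∏ i ∈ Finset.univ.erase l, α i)⁻¹ • factorMatrix l (raisingMatrix K (r l))) -
      ((∏ i ∈ Finset.univ.erase l, α i)⁻¹ • factorMatrix l (raisingMatrix K (r l))) *
        ((∏ i ∈ Finset.univ.erase j, α i) • factorMatrix j (jordanBlock (0 : K) (r j))) = 0 := by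
    intro j l hl
    rw [smul_mul_smul_comm, smul_mul_smul_comm, factorMatrix_commute hl.symm, mul_comm, sub_self]
  have h2 : ∀ j : Fin t,
      ((∏ i ∈ Finset.univ.erase j, α i) • factorMatrix j (jordanBlock (0 : K) (r j))) *
        ((∏ i ∈ Finset.univ.erase j, α i)⁻¹ • factorMatrix j (raisingMatrix K (r j))) -
      ((∏ i ∈ Finset.univ.erase j, α i)⁻¹ • factorMatrix j (raisingMatrix K (r j))) *
        ((∏ i ∈ Finset.univ.erase j, α i) • factorMatrix j (jordanBlock (0 : K) (r j))) =
      Matrix.diagonal fun x => (r j : K) - 1 - 2 * ((x j : ℕ) : K) := by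
    intro j
    rw [smul_mul_smul_comm, smul_mul_smul_comm, mul_inv_cancel₀ (hγ j), inv_mul_cancel₀ (hγ j),
      one_smul, one_smul, factorMatrix_mul, factorMatrix_mul, ← factorMatrix_sub,
      jordanBlock_raisingMatrix_commutator, factorMatrix_diagonal]
  rw [Finset.sum_congr rfl
    (g := fun j => Matrix.diagonal fun x => (r j : K) - 1 - 2 * ((x j : ℕ) : K)) fun j _ => by
      rw [← Finset.sum_sub_distrib, Finset.sum_eq_single j (fun l _ hl => h1 j l hl) (by simp),
        h2 j], diagonal_finset_sum]
  congr 1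
  ext x
  have hn' : (n : K) = (∑ j, (r j : K)) - t := by exact_mod_cast congrArg (Int.cast : ℤ → K) hn
  rw [hn', tupleDegree, Nat.cast_sum, Finset.mul_sum, Finset.sum_sub_distrib,
    Finset.sum_sub_distrib]
  simp

/-- In a nonzero entry every coordinate stays (factor α_i) or rises by one (factor 1). Off the
diagonal, the degree bound allows exactly one rise, leaving the product of the other α_i. -/
theorem tensorMatrix_jordanBlock_sub_apply (α : Fin t → K) (x y : (j : Fin t) → Fin (r j))
    (h : tupleDegree y ≤ tupleDegree x + 1) :
    (tensorMatrix (fun j => jordanBlock (α j) (r j)) -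
      (∏ j, α j) • (1 : Matrix ((j : Fin t) → Fin (r j)) ((j : Fin t) → Fin (r j)) K)) x y =
      loweringSum α x y := by
  rw [Matrix.sub_apply, Matrix.smul_apply, smul_eq_mul]
  by_cases hxy : x = y
  · subst hxy
    rw [loweringSum_apply_eq_zero _ _ _ (by omega)]
    simp [tensorMatrix, jordanBlock]
  rw [Matrix.one_apply_ne hxy, mul_zero, sub_zero, tensorMatrix, Matrix.of_apply]
  by_cases hgood : ∀ j, x j = y j ∨ (x j : ℕ) + 1 = y j
  · have hle : ∀ j, (x j : ℕ) ≤ y j := fun j => by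
      rcases hgood j with h | h
      · rw [h]
      · omega
    obtain ⟨j, hj⟩ := Function.ne_iff.1 hxy
    have hj' : (x j : ℕ) + 1 = y j := (hgood j).resolve_left hj
    have hrest : ∀ i, i ≠ j → x i = y i := by
      intro i hi
      by_contra hne
      have hi' : (x i : ℕ) + 1 = y i := (hgood i).resolve_left hne
      rw [tupleDegree, tupleDegree, ← Finset.add_sum_erase _ _ (Finset.mem_univ j),
        ← Finset.add_sum_erase _ (fun i => (x i : ℕ)) (Finset.mem_univ j)] at h
      have : ∑ i ∈ Finset.univ.erase j, (x i : ℕ) < ∑ i ∈ Finset.univ.erase j, (y i : ℕ) :=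
        Finset.sum_lt_sum (fun i _ => hle i)
          ⟨i, Finset.mem_erase.2 ⟨hi, Finset.mem_univ i⟩, by omega⟩
      omega
    rw [loweringSum_apply, Finset.sum_eq_single j]
    · rw [factorMatrix_apply_of_forall _ _ _ _ hrest, jordanBlock_zero_apply, if_pos hj', mul_one,
        ← Finset.mul_prod_erase _ _ (Finset.mem_univ j)]
      rw [show jordanBlock (α j) (r j) (x j) (y j) = 1 by simp [jordanBlock, hj, hj'], one_mul]
      refine Finset.prod_congr rfl fun i hi => ?_
      simp [jordanBlock, hrest i (Finset.ne_of_mem_erase hi)]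
    · intro l _ hl
      rw [factorMatrix_apply_of_ne l _ x y j hl.symm hj, mul_zero]
    · simp
  · push Not at hgood
    obtain ⟨j, hj, hj'⟩ := hgood
    rw [Finset.prod_eq_zero (Finset.mem_univ j) (by simp [jordanBlock, hj, hj']),
      loweringSum_apply, Finset.sum_eq_zero]
    intro l _
    by_cases hl : j = l
    · subst hl
      rw [factorMatrix_apply, jordanBlock_zero_apply, if_neg hj', zero_mul, mul_zero]
    · rw [factorMatrix_apply_of_ne l _ x y j hl hj, mul_zero]

theorem tupleDegree_rev (n : ℕ) (hn : (n : ℤ) = (∑ j, (r j : ℤ)) - t)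
    (x : (j : Fin t) → Fin (r j)) :
    tupleDegree (fun j => (x j).rev) + tupleDegree x = n := by
  have h1 : ∀ j, (((x j).rev : ℕ) : ℤ) + (x j : ℕ) = (r j : ℤ) - 1 := fun j => by
    rw [Fin.val_rev]
    omega
  have h2 : (tupleDegree (fun j => (x j).rev) : ℤ) + tupleDegree x = n := by
    rw [hn, tupleDegree, tupleDegree]
    push_cast
    rw [← Finset.sum_add_distrib, Finset.sum_congr rfl fun j _ => h1 j, Finset.sum_sub_distrib]
    simp
  exact_mod_cast h2

theorem tupleDegree_le (n : ℕ) (hn : (n : ℤ) = (∑ j, (r j : ℤ)) - t)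
    (x : (j : Fin t) → Fin (r j)) : tupleDegree x ≤ n := by
  have := tupleDegree_rev n hn x
  omega

/-- Reversing all indices replaces the degree `d` by `n - d`. -/
theorem card_tupleDegree_symm (n : ℕ) (hn : (n : ℤ) = (∑ j, (r j : ℤ)) - t) (p q : ℕ → Prop)
    [DecidablePred p] [DecidablePred q] (hpq : ∀ d e, d + e = n → (p d ↔ q e)) :
    (Finset.univ.filter fun x : (j : Fin t) → Fin (r j) => p (tupleDegree x)).card =
      (Finset.univ.filter fun x : (j : Fin t) → Fin (r j) => q (tupleDegree x)).card := by
  refine Finset.card_bij' (fun x _ j => (x j).rev) (fun x _ j => (x j).rev) ?_ ?_ ?_ ?_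
  · intro x hx
    have := tupleDegree_rev n hn x
    simp only [Finset.mem_filter, Finset.mem_univ, true_and] at hx ⊢
    exact (hpq _ _ (by omega)).1 hx
  · intro x hx
    have := tupleDegree_rev n hn x
    simp only [Finset.mem_filter, Finset.mem_univ, true_and] at hx ⊢
    exact (hpq _ _ this).2 hx
  · intro x _
    ext1 j
    simp
  · intro x _
    ext1 j
    simp

/-- Expanding the product of the geometric sums gives one monomial for each tuple, with exponent its
degree. -/
theorem blockCoeff_eq_card (r : Fin t → ℕ) (k : ℤ) :
    blockCoeff r k =
      (Finset.univ.filter fun x : (j : Fin t) → Fin (r j) => (tupleDegree x : ℤ) = k).card := by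
  unfold blockCoeff
  split_ifs with hk
  · have : ∀ j, ∑ i ∈ Finset.range (r j), (Polynomial.X : Polynomial ℤ) ^ i =
        ∑ i : Fin (r j), (Polynomial.X : Polynomial ℤ) ^ (i : ℕ) := fun j =>
      Finset.sum_range _
    simp only [this, Finset.prod_univ_sum, Fintype.piFinset_univ, Finset.prod_pow_eq_pow_sum,
      Polynomial.finsetSum_coeff, Polynomial.coeff_X_pow]
    rw [Finset.sum_boole]
    congr 2
    ext x
    simp only [Finset.mem_filter, Finset.mem_univ, true_and]
    change k.toNat = tupleDegree x ↔ (tupleDegree x : ℤ) = k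
    omega
  · rw [eq_comm, Nat.cast_eq_zero, Finset.card_eq_zero, Finset.filter_eq_empty_iff]
    intro x _ hx
    omega

end Tensor

/-! ### Block multiplicities of the tensor product -/

section Main

variable {K : Type*} [Field K] {t : ℕ} {r : Fin t → ℕ}

theorem isUnit_add_smul_one_of_isNilpotent {ι : Type*} [Fintype ι] [DecidableEq ι]
    {M : Matrix ι ι K} (hM : IsNilpotent M) {c : K} (hc : c ≠ 0) :
    IsUnit (M + c • (1 : Matrix ι ι K)) := by
  have hu : IsUnit (c • (1 : Matrix ι ι K)) := by
    rw [← Algebra.algebraMap_eq_smul_one]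
    exact (isUnit_iff_ne_zero.2 hc).map _
  exact hM.isUnit_add_right_of_commute hu ((Commute.one_right M).smul_right c)

theorem isNilpotent_tensorMatrix_jordanBlock_sub (α : Fin t → K) (n : ℕ)
    (hn : (n : ℤ) = (∑ j, (r j : ℤ)) - t) :
    IsNilpotent (tensorMatrix (fun j => jordanBlock (α j) (r j)) - (∏ j, α j) • 1) :=
  ⟨n + 1, filtered_pow_eq_zero (tupleDegree_le n hn) (loweringSum_apply_eq_zero α)
    (tensorMatrix_jordanBlock_sub_apply α)⟩

theorem nullity_tensorMatrix_jordanBlock_sub_pow [CharZero K] (α : Fin t → K)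
    (hα : ∀ j, α j ≠ 0) (n : ℕ) (hn : (n : ℤ) = (∑ j, (r j : ℤ)) - t) (i : ℕ) :
    (nullity ((tensorMatrix (fun j => jordanBlock (α j) (r j)) - (∏ j, α j) • 1) ^ i) : ℤ) =
      (Finset.univ.filter fun x : (j : Fin t) → Fin (r j) =>
        2 * (tupleDegree x : ℤ) ≤ n + i).card -
      (Finset.univ.filter fun x : (j : Fin t) → Fin (r j) =>
        2 * (tupleDegree x : ℤ) ≤ n - i).card := by
  have h := nullity_filtered_pow (tupleDegree_le n hn) (loweringSum_apply_eq_zero α)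
    (raisingSum_apply_eq_zero α) (loweringSum_raisingSum_commutator α hα n hn)
    (fun d hd => card_tupleDegree_symm n hn (· = n - d) (· = d) fun a b hab => by
      constructor <;> intro h <;> omega)
    (tensorMatrix_jordanBlock_sub_apply α) i
  have h1 : (Finset.univ.filter fun x : (j : Fin t) → Fin (r j) =>
      2 * (tupleDegree x : ℤ) ≤ n + i) = Finset.univ.filter fun x => 2 * tupleDegree x ≤ n + i := by
    ext x
    simp only [Finset.mem_filter, Finset.mem_univ, true_and]
    omega
  have h2 : (Finset.univ.filter fun x : (j : Fin t) → Fin (r j) =>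
      2 * (tupleDegree x : ℤ) ≤ n - i) = Finset.univ.filter fun x => 2 * tupleDegree x + i ≤ n := by
    ext x
    simp only [Finset.mem_filter, Finset.mem_univ, true_and]
    omega
  rw [h1, h2]
  omega

theorem card_filter_le_eq_add {ι : Type*} [Fintype ι] (f : ι → ℤ) (m : ℤ) :
    ((Finset.univ.filter fun x => f x ≤ m).card : ℤ) =
      (Finset.univ.filter fun x => f x ≤ m - 1).card + (Finset.univ.filter fun x => f x = m).card := by
  classical
  rw [← Nat.cast_add, ← Finset.card_union_of_disjoint]
  · congr 2
    ext x
    simp only [Finset.mem_union, Finset.mem_filter, Finset.mem_univ, true_and]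
    omega
  · rw [Finset.disjoint_filter]
    intro x _
    omega

theorem IsJordanForm.count_tensorMatrix_jordanBlock [DecidableEq K] [CharZero K] (α : Fin t → K)
    (hα : ∀ j, α j ≠ 0) (n : ℕ) (hn : (n : ℤ) = (∑ j, (r j : ℤ)) - t) {S : Multiset (K × ℕ)}
    (hS : IsJordanForm (tensorMatrix fun j => jordanBlock (α j) (r j)) S) (s : ℕ) :
    (S.count (∏ j, α j, s + 1) : ℤ) =
      (Finset.univ.filter fun x : (j : Fin t) → Fin (r j) =>
        2 * (tupleDegree x : ℤ) = (n : ℤ) - s).card -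
      (Finset.univ.filter fun x : (j : Fin t) → Fin (r j) =>
        2 * (tupleDegree x : ℤ) = (n : ℤ) - s - 2).card := by
  have h := congrArg (Nat.cast : ℕ → ℤ) (hS.two_mul_nullity (∏ j, α j) s)
  push_cast at h
  simp only [nullity_tensorMatrix_jordanBlock_sub_pow α hα n hn] at h
  push_cast at h
  -- The second difference telescopes to the counts of tuples with 2 * degree equal to n + s + 1, n
  -- + s + 2, n - s and n - s - 1, with signs +, -, +, -. Reversal cancels the first with the last
  -- and turns n + s + 2 into n - s - 2.
  have e1 := card_filter_le_eq_add
    (fun x : (j : Fin t) → Fin (r j) => 2 * (tupleDegree x : ℤ)) ((n : ℤ) + (s + 2))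
  have e2 := card_filter_le_eq_add
    (fun x : (j : Fin t) → Fin (r j) => 2 * (tupleDegree x : ℤ)) ((n : ℤ) + (s + 1))
  have e3 := card_filter_le_eq_add
    (fun x : (j : Fin t) → Fin (r j) => 2 * (tupleDegree x : ℤ)) ((n : ℤ) - s)
  have e4 := card_filter_le_eq_add
    (fun x : (j : Fin t) → Fin (r j) => 2 * (tupleDegree x : ℤ)) ((n : ℤ) - (s + 1))
  have s1 := card_tupleDegree_symm n hn (fun d => 2 * (d : ℤ) = (n : ℤ) + (s + 2))
    (fun d => 2 * (d : ℤ) = (n : ℤ) - s - 2) (fun a b hab => by omega)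
  have s2 := card_tupleDegree_symm n hn (fun d => 2 * (d : ℤ) = (n : ℤ) + (s + 1))
    (fun d => 2 * (d : ℤ) = (n : ℤ) - (s + 1)) (fun a b hab => by omega)
  rw [show (n : ℤ) + (s + 2) - 1 = n + (s + 1) by ring] at e1
  rw [show (n : ℤ) + (s + 1) - 1 = n + s by ring] at e2
  rw [show (n : ℤ) - s - 1 = n - (s + 1) by ring] at e3
  rw [show (n : ℤ) - (s + 1) - 1 = n - (s + 2) by ring] at e4
  linarith

theorem IsJordanForm.count_tensorMatrix_of_even [DecidableEq K] [CharZero K] (α : Fin t → K)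
    (hα : ∀ j, α j ≠ 0) (n : ℕ) (hn : (n : ℤ) = (∑ j, (r j : ℤ)) - t) {S : Multiset (K × ℕ)}
    (hS : IsJordanForm (tensorMatrix fun j => jordanBlock (α j) (r j)) S) (s k : ℕ)
    (hk : 2 * k + s = n) :
    (S.count (∏ j, α j, s + 1) : ℤ) = blockCoeff r k - blockCoeff r ((k : ℤ) - 1) := by
  rw [hS.count_tensorMatrix_jordanBlock α hα n hn, blockCoeff_eq_card, blockCoeff_eq_card]
  congr 4 <;> ext x <;> omega

theorem IsJordanForm.count_tensorMatrix_of_not_even [DecidableEq K] [CharZero K] (α : Fin t → K)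
    (hα : ∀ j, α j ≠ 0) (n : ℕ) (hn : (n : ℤ) = (∑ j, (r j : ℤ)) - t) {S : Multiset (K × ℕ)}
    (hS : IsJordanForm (tensorMatrix fun j => jordanBlock (α j) (r j)) S) (s : ℕ)
    (hk : ∀ k, 2 * k + s ≠ n) : S.count (∏ j, α j, s + 1) = 0 := by
  have h := hS.count_tensorMatrix_jordanBlock α hα n hn s
  rw [Finset.filter_false_of_mem, Finset.filter_false_of_mem] at h
  · simpa using h
  · intro x _ hx
    exact hk (tupleDegree x + 1) (by omega)
  · intro x _ hx
    exact hk (tupleDegree x) (by omega)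

/-- For a ≠ α, subtracting a leaves a nilpotent matrix plus a nonzero scalar, which is invertible,
so all nullities are zero. -/
theorem IsJordanForm.count_tensorMatrix_of_ne [DecidableEq K] (α : Fin t → K) (n : ℕ)
    (hn : (n : ℤ) = (∑ j, (r j : ℤ)) - t) {S : Multiset (K × ℕ)}
    (hS : IsJordanForm (tensorMatrix fun j => jordanBlock (α j) (r j)) S) {a : K}
    (ha : a ≠ ∏ j, α j) (s : ℕ) : S.count (a, s + 1) = 0 := by
  have hu := isUnit_add_smul_one_of_isNilpotent
    (isNilpotent_tensorMatrix_jordanBlock_sub α n hn) (sub_ne_zero.2 ha.symm)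
  rw [sub_smul, sub_add_sub_cancel] at hu
  have h := hS.two_mul_nullity a s
  rw [nullity_eq_zero_of_isUnit (hu.pow _)] at h
  omega

theorem IsJordanForm.eq_of_tensorMatrix_jordanBlock [CharZero K] (α : Fin t → K)
    (hα : ∀ j, α j ≠ 0) (n : ℕ) (hn : (n : ℤ) = (∑ j, (r j : ℤ)) - t) {S : Multiset (K × ℕ)}
    (hS : IsJordanForm (tensorMatrix fun j => jordanBlock (α j) (r j)) S) :
    S = ∑ k ∈ Finset.range (n / 2 + 1),
      (blockCoeff r k - blockCoeff r ((k : ℤ) - 1)).toNat •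
        ({(∏ j, α j, n + 1 - 2 * k)} : Multiset (K × ℕ)) := by
  classical
  ext ⟨a, s⟩
  simp only [Multiset.count_sum', Multiset.count_nsmul, Multiset.count_singleton, Prod.mk.injEq]
  rcases s with _ | s
  · rw [hS.count_zero, Finset.sum_eq_zero]
    intro k hk
    rw [Finset.mem_range] at hk
    rw [if_neg (by omega), mul_zero]
  by_cases ha : a = ∏ j, α j
  · subst ha
    by_cases hk : ∃ k, 2 * k + s = n
    · obtain ⟨k, hk⟩ := hk
      rw [Finset.sum_eq_single k]
      · rw [← hS.count_tensorMatrix_of_even α hα n hn s k hk, if_pos ⟨rfl, by omega⟩]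
        simp
      · intro l hl hlk
        rw [Finset.mem_range] at hl
        rw [if_neg (by omega), mul_zero]
      · intro h
        rw [Finset.mem_range] at h
        omega
    · push Not at hk
      rw [hS.count_tensorMatrix_of_not_even α hα n hn s hk, Finset.sum_eq_zero]
      intro l hl
      rw [Finset.mem_range] at hl
      have := hk l
      rw [if_neg (by omega), mul_zero]
  · rw [hS.count_tensorMatrix_of_ne α n hn ha, Finset.sum_eq_zero]
    intro l _
    rw [if_neg (fun h => ha h.1), mul_zero]

end Main

theorem proposition5p4 {K : Type*} [Field K] [IsAlgClosed K] [CharZero K]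
    (t : ℕ) (α : Fin t → K) (hα : ∀ j, α j ≠ 0)
    (r : Fin t → ℕ) (hr : ∀ j, 0 < r j) (hmono : Monotone r)
    (n : ℕ) (hn : (n : ℤ) = (∑ j, (r j : ℤ)) - t) :
    (∀ k : ℕ, k ≤ n / 2 → 0 ≤ blockCoeff r k - blockCoeff r ((k : ℤ) - 1)) ∧
    ∀ S : Multiset (K × ℕ),
      IsJordanForm (tensorMatrix fun j => jordanBlock (α j) (r j)) S ↔
        S = ∑ k ∈ Finset.range (n / 2 + 1),
          (blockCoeff r k - blockCoeff r ((k : ℤ) - 1)).toNat •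
            ({(∏ j, α j, n + 1 - 2 * k)} : Multiset (K × ℕ)) := by
  classical
  obtain ⟨T, hT⟩ := exists_isJordanForm _ _ (isNilpotent_tensorMatrix_jordanBlock_sub α n hn)
  refine ⟨fun k hk => ?_, fun S => ⟨fun hS => hS.eq_of_tensorMatrix_jordanBlock α hα n hn, ?_⟩⟩
  · rw [← hT.count_tensorMatrix_of_even α hα n hn (n - 2 * k) k (by omega)]
    exact Int.natCast_nonneg _
  -- The existing form T must equal the stated multiset, so that multiset is itself a Jordan form.
  · rintro rfl
    rwa [← hT.eq_of_tensorMatrix_jordanBlock α hα n hn]
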